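/- Let $G$ be a finite group of order $r\ge 3$ and let $\rho\colon G\to O(d)$ be an orthogonal representation that is faithful (injective) and full-dimensional, i.e. there is some $u\in\mathbb{R}^d$ such that the affine hull of the orbit $G\cdot u=\{\rho(g)u : g\in G\}$ is all of $\mathbb{R}^d$. A free orbit polytope for $\rho$ is a polytope $P(G;u,a)=\mathrm{Conv}(a+G\cdot u)$ with $a\in\mathbb{R}^d$ and $u\in\mathbb{R}^d\setminus\{0\}$ such that $\rho(g)u=u$ only for $g=1$. A set $S\subset\mathbb{R}^d$ can be $P$-partitioned (into $r$ parts) if there are a partition $A_1,\dots,A_r$ of $S$ and points $y_1\in\mathrm{Conv}(A_1),\dots,y_r\in\mathrm{Conv}(A_r)$ such that $\{y_1,\dots,y_r\}$ is the vertex set of the polytope $P$. A property holds for a generic set of $N$ points in $\mathbb{R}^d$ if there is a dense open subset of $(\mathbb{R}^d)^N$, with complement of Lebesgue measure zero, such that $\{x_1,\dots,x_N\}$ has the property for every $N$-tuple $(x_1,\dots,x_N)$ in this subset. Then: (1) A generic set of $(r-2)(d+1)+2$ points in $\mathbb{R}^d$ can be $P$-partitioned by some $d$-dimensional free orbit polytope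 $P$ for $\rho$. (2) For every $N<(r-2)(d+1)+2$, a generic set of $N$ points in $\mathbb{R}^d$ cannot be $P$-partitioned by any free orbit polytope $P$ for $\rho$, of whatever dimension. -/

import Mathlib

/-- The orthogonal group `O(d)`, as the group of linear isometries of Euclidean space `ℝ^d`
onto itself. -/
abbrev OrthGroup (d : ℕ) : Type :=
  EuclideanSpace ℝ (Fin d) ≃ₗᵢ[ℝ] EuclideanSpace ℝ (Fin d)

/-- A property holds for a generic set of `N` points of `ℝ^d` if it holds for all `N`-tuples in
some dense open subset of `(ℝ^d)^N` whose complement is a Lebesgue null set. -/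
def HoldsGenerically {N d : ℕ} (p : (Fin N → EuclideanSpace ℝ (Fin d)) → Prop) : Prop :=
  ∃ U : Set (Fin N → EuclideanSpace ℝ (Fin d)),
    IsOpen U ∧ Dense U ∧ MeasureTheory.volume Uᶜ = 0 ∧ ∀ x ∈ U, p x

/-- An orthogonal representation is full-dimensional if the affine hull of some orbit `G · u` is
all of `ℝ^d`. -/
def IsFullDimensional {G : Type*} [Group G] {d : ℕ} (ρ : G →* OrthGroup d) : Prop :=
  ∃ u : EuclideanSpace ℝ (Fin d), affineSpan ℝ (Set.range fun g : G => ρ g u) = ⊤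

/-- The orbit polytope `P(G; u, a) = Conv(a + G · u)`. -/
def orbitPolytope {G : Type*} [Group G] {d : ℕ} (ρ : G →* OrthGroup d)
    (u a : EuclideanSpace ℝ (Fin d)) : Set (EuclideanSpace ℝ (Fin d)) :=
  convexHull ℝ (Set.range fun g : G => a + ρ g u)

/-- `P` is a free orbit polytope for `ρ`: it is `P(G; u, a)` for some translation vector `a` and
some `u ≠ 0` with trivial stabilizer. -/
def IsFreeOrbitPolytope {G : Type*} [Group G] {d : ℕ} (ρ : G →* OrthGroup d)
    (P : Set (EuclideanSpace ℝ (Fin d))) : Prop :=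
  ∃ u a : EuclideanSpace ℝ (Fin d),
    u ≠ 0 ∧ (∀ g : G, ρ g u = u → g = 1) ∧ P = orbitPolytope ρ u a

/-- The set `S` can be `P`-partitioned into `r` parts: there are a partition `A₁, …, A_r` of `S`
and points `yᵢ ∈ Conv(Aᵢ)`, one from each convex hull, such that `{y₁, …, y_r}` is the vertex set
(the set of extreme points) of the polytope `P`. The parts are automatically nonempty. -/
def CanBePartitioned {d : ℕ} (r : ℕ) (S P : Set (EuclideanSpace ℝ (Fin d))) : Prop :=
  ∃ A : Fin r → Set (EuclideanSpace ℝ (Fin d)),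
    Pairwise (fun i j => Disjoint (A i) (A j)) ∧ (⋃ i, A i) = S ∧
    ∃ y : Fin r → EuclideanSpace ℝ (Fin d),
      (∀ i, y i ∈ convexHull ℝ (A i)) ∧ Set.range y = Set.extremePoints ℝ P

/-! Both halves rest on one dimension count: `(r-2)(d+1)+2 = r(d+1) - 2d`.

Existence is Sarkaria's trick. Placing `(x_j, 1)` in coordinate `g` of `(ℝ^d × ℝ)^G` gives each
point one copy per group element. Modulo the space `L` of tuples `(a + ρ g u, t)_g`, of dimension
`2d+1`, the copies of each point average to zero. Colorful Carathéodory then selects one copy per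
point, that is, a coloring by `G`, with a convex combination in `L`; after rescaling this is an
orbit coincidence (`exists_mem_orbitCoincidence_univ`).

That `u` may be degenerate. For a fixed coloring, solving for one pivot point per color parametrizes
the coincidences by `(N-r)(d+1) + 2d` numbers, against `Nd` for all tuples. With fewer points than
the threshold, all coincidences form a null set; at the threshold, those with `u` in a null closed
set do (`volume_orbitCoincidence_eq_zero`). These sets are also closed, so avoiding them is generic.
-/

/-! ### Colorful Carathéodory -/

/-- **Colorful Carathéodory theorem**: if the origin lies in the convex hull of each of more than
`dim F` finite color classes, then it lies in the convex hull of a colorful selection. -/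
theorem exists_zero_mem_convexHull_range_selection {F : Type*} [NormedAddCommGroup F]
    [InnerProductSpace ℝ F] [FiniteDimensional ℝ F] {ι κ : Type*} [Finite ι] [Finite κ]
    [Nonempty κ] (hcard : Module.finrank ℝ F < Nat.card ι) (p : ι → κ → F)
    (hp : ∀ j, (0 : F) ∈ convexHull ℝ (Set.range (p j))) :
    ∃ c : ι → κ, (0 : F) ∈ convexHull ℝ (Set.range fun j => p j (c j)) := by
  classical
  have : Fintype ι := Fintype.ofFinite ι
  have hι : Nonempty ι := (Nat.card_pos_iff.1 (by omega)).1
  set H : (ι → κ) → Set F := fun c => convexHull ℝ (Set.range fun j => p j (c j)) with hH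
  have hcomp : IsCompact (⋃ c, H c) :=
    isCompact_iUnion fun c => (Set.finite_range _).isCompact_convexHull ℝ
  obtain ⟨q, hq, hmin⟩ := hcomp.exists_isMinOn
    (by
      obtain ⟨k⟩ := ‹Nonempty κ›
      obtain ⟨j⟩ := hι
      exact ⟨p j k, Set.mem_iUnion.2 ⟨fun _ => k, subset_convexHull ℝ _ ⟨j, rfl⟩⟩⟩)
    (continuous_norm.continuousOn)
  -- Variational inequality for `q`, the point of least norm over all colorful hulls.
  have hinner : ∀ c, q ∈ H c → ∀ z ∈ H c, ‖q‖ ^ 2 ≤ inner ℝ q z := by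
    intro c hqc z hz
    have hle : ∀ w ∈ H c, ‖q‖ ≤ ‖w‖ := fun w hw => hmin (Set.mem_iUnion.2 ⟨c, hw⟩)
    have hne : Nonempty (H c) := ⟨⟨q, hqc⟩⟩
    have key := (norm_eq_iInf_iff_real_inner_le_zero (u := (0 : F))
      (convex_convexHull ℝ (Set.range fun j => p j (c j))) hqc).1 ?_ z hz
    · simp only [zero_sub, inner_neg_left, inner_sub_right, real_inner_self_eq_norm_sq] at key
      linarith
    · apply le_antisymm
      · exact le_ciInf fun w => by simpa using hle w w.2
      · exact ciInf_le ⟨0, by rintro _ ⟨w, rfl⟩; positivity⟩ (⟨q, hqc⟩ : H c)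
  obtain ⟨c, hqc⟩ := Set.mem_iUnion.1 hq
  by_cases hq0 : q = 0
  · exact ⟨c, hq0 ▸ hqc⟩
  have hqpos : 0 < ‖q‖ ^ 2 := by positivity
  exfalso
  obtain ⟨ι', _, z, w, hz, hind, hw, hw1, hwq⟩ := eq_pos_convex_span_of_mem_convexHull hqc
  have hzin : ∀ i, inner ℝ q (z i) = ‖q‖ ^ 2 := by
    have hnn : ∀ i ∈ Finset.univ, 0 ≤ w i * (inner ℝ q (z i) - ‖q‖ ^ 2) := fun i _ =>
      mul_nonneg (hw i).le
        (sub_nonneg.2 (hinner c hqc _ (subset_convexHull ℝ _ (hz ⟨i, rfl⟩))))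
    have hsum : ∑ i, w i * (inner ℝ q (z i) - ‖q‖ ^ 2) = 0 := by
      have : inner ℝ q (∑ i, w i • z i) = ‖q‖ ^ 2 := by
        rw [hwq, real_inner_self_eq_norm_sq]
      simp only [inner_sum, inner_smul_right] at this
      simp only [mul_sub, Finset.sum_sub_distrib, this, ← Finset.sum_mul, hw1, one_mul, sub_self]
    intro i
    have := (Finset.sum_eq_zero_iff_of_nonneg hnn).1 hsum i (Finset.mem_univ i)
    rcases mul_eq_zero.1 this with h | h
    · exact absurd h (hw i).ne'
    · linarith
  -- The `z i` lie on a hyperplane orthogonal to `q`, so at most `dim F` of them are affinely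
  -- independent, and some color `j₀` is not needed to express `q`. Its point can be exchanged for
  -- one on the other side of the hyperplane.
  have hlt : Module.finrank ℝ (vectorSpan ℝ (Set.range z)) < Module.finrank ℝ F := by
    apply Submodule.finrank_lt
    intro htop
    have hle : vectorSpan ℝ (Set.range z) ≤ (ℝ ∙ q)ᗮ := by
      rw [vectorSpan_def, Submodule.span_le]
      rintro _ ⟨_, ⟨i, rfl⟩, _, ⟨j, rfl⟩, rfl⟩
      simp [Submodule.mem_orthogonal_singleton_iff_inner_right, inner_sub_right, hzin]
    have : q ∈ (ℝ ∙ q)ᗮ := hle (htop ▸ Submodule.mem_top)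
    rw [Submodule.mem_orthogonal_singleton_iff_inner_right, inner_self_eq_zero] at this
    exact hq0 this
  have hcard' := hind.card_le_finrank_succ
  choose k hk using fun i => hz (Set.mem_range_self i)
  obtain ⟨j₀, hj₀⟩ : ∃ j₀, ∀ i, k i ≠ j₀ := by
    by_contra! hcon
    have := Fintype.card_le_of_surjective k hcon
    rw [Nat.card_eq_fintype_card] at hcard
    omega
  obtain ⟨g, hg⟩ : ∃ g, inner ℝ q (p j₀ g) ≤ 0 := by
    by_contra! hcon
    have hconv : Convex ℝ {y : F | 0 < inner ℝ q y} :=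
      convex_halfSpace_gt (innerSL ℝ q).toLinearMap.isLinear 0
    have := convexHull_min (by rintro _ ⟨g, rfl⟩; exact hcon g) hconv (hp j₀)
    simp at this
  have hq' : q ∈ H (Function.update c j₀ g) := by
    rw [← hwq]
    refine (convex_convexHull ℝ _).sum_mem (fun i _ => (hw i).le) hw1 fun i _ => ?_
    refine subset_convexHull ℝ _ ⟨k i, ?_⟩
    simp [Function.update_of_ne (hj₀ i), hk]
  have := hinner _ hq' (p j₀ g) (subset_convexHull ℝ _ ⟨j₀, by simp⟩)
  linarith

/-! ### Orbit coincidences: closedness and measure -/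

section OrbitCoincidence

variable {G : Type*} [Group G] {d : ℕ}

/-- An orthogonal representation with a full-dimensional orbit has no nonzero fixed vector, so the
vectors of each orbit sum to zero. -/
theorem IsFullDimensional.sum_orbit_eq_zero [Fintype G] {ρ : G →* OrthGroup d}
    (hfull : IsFullDimensional ρ) (u : EuclideanSpace ℝ (Fin d)) : ∑ g, ρ g u = 0 := by
  obtain ⟨v, hv⟩ := hfull
  set w := ∑ g, ρ g u with hw
  have hfix : ∀ h, ρ h w = w := by
    intro h
    rw [hw, map_sum]
    exact Fintype.sum_equiv (Equiv.mulLeft h) _ _ fun g => by simp [map_mul]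
  -- Since `w` is fixed, `⟪w, ρ g v⟫` does not depend on `g`, so the orbit of `v` lies in a
  -- hyperplane orthogonal to `w` unless `w = 0`.
  have hle : vectorSpan ℝ (Set.range fun g => ρ g v) ≤ (ℝ ∙ w)ᗮ := by
    rw [vectorSpan_def, Submodule.span_le]
    rintro _ ⟨_, ⟨g, rfl⟩, _, ⟨h, rfl⟩, rfl⟩
    have key : ∀ g, inner ℝ w (ρ g v) = inner ℝ w v := fun g => by
      conv_lhs => rw [← hfix g]
      exact (ρ g).inner_map_map w v
    simp [Submodule.mem_orthogonal_singleton_iff_inner_right, inner_sub_right, key]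
  rw [← direction_affineSpan, hv, AffineSubspace.direction_top] at hle
  have : w ∈ (ℝ ∙ w)ᗮ := hle Submodule.mem_top
  rwa [Submodule.mem_orthogonal_singleton_iff_inner_right, inner_self_eq_zero] at this

/-- The tuples of points whose color classes carry convex combinations forming a translated orbit
`a + ρ(g) u`, indexed by the colors, of some vector `u ∈ B`. -/
def orbitCoincidence {ι : Type*} [Fintype ι] (ρ : G →* OrthGroup d)
    (B : Set (EuclideanSpace ℝ (Fin d))) (c : ι → G) : Set (ι → EuclideanSpace ℝ (Fin d)) :=
  open Classical in
  {x | ∃ w : ι → ℝ, (∀ j, 0 ≤ w j) ∧ (∀ g, ∑ j with c j = g, w j = 1) ∧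
    ∃ a, ∃ u ∈ B, ∀ g, ∑ j with c j = g, w j • x j = a + ρ g u}

/-- The weights range over a compact set, along which projection is a closed map. The unbounded
parameters `a` and `u` are eliminated: orbits sum to zero, so `a` is the mean of the class points
and `u` is the point of color `1` minus `a`. -/
theorem isClosed_orbitCoincidence {ι : Type*} [Fintype ι] [Finite G] {ρ : G →* OrthGroup d}
    (hfull : IsFullDimensional ρ) {B : Set (EuclideanSpace ℝ (Fin d))} (hB : IsClosed B)
    (c : ι → G) : IsClosed (orbitCoincidence ρ B c) := by
  classical
  have : Fintype G := Fintype.ofFinite G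
  set K : Set (ι → ℝ) := {w | (∀ j, 0 ≤ w j) ∧ ∀ g, ∑ j with c j = g, w j = 1} with hK
  have hKc : IsCompact K := by
    refine (isCompact_univ_pi fun _ : ι => isCompact_Icc (a := (0 : ℝ)) (b := 1)).of_isClosed_subset
      ?_ ?_
    · have h0 : IsClosed {w : ι → ℝ | 0 ≤ w} := isClosed_Ici
      have h1 : IsClosed {w : ι → ℝ | (fun g => ∑ j with c j = g, w j) = fun _ : G => 1} :=
        isClosed_eq (by fun_prop) continuous_const
      convert h0.inter h1 using 1
      ext w
      simp [hK, Pi.le_def, funext_iff]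
    · rintro w ⟨h0, h1⟩ j -
      refine ⟨h0 j, ?_⟩
      rw [← h1 (c j)]
      exact Finset.single_le_sum (f := w) (fun i _ => h0 i) (by simp)
  have : CompactSpace K := isCompact_iff_compactSpace.1 hKc
  let y : K × (ι → EuclideanSpace ℝ (Fin d)) → G → EuclideanSpace ℝ (Fin d) :=
    fun p g => ∑ j with c j = g, p.1.1 j • p.2 j
  let m : K × (ι → EuclideanSpace ℝ (Fin d)) → EuclideanSpace ℝ (Fin d) :=
    fun p => (Fintype.card G : ℝ)⁻¹ • ∑ g, y p g
  have hy : ∀ g, Continuous fun p => y p g := fun g =>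
    continuous_finsetSum _ fun j _ =>
      (((continuous_apply j).comp continuous_subtype_val).comp continuous_fst).smul
        ((continuous_apply j).comp continuous_snd)
  have hm : Continuous m :=
    (continuous_finsetSum Finset.univ fun g _ => hy g).const_smul (Fintype.card G : ℝ)⁻¹
  set C : Set (K × (ι → EuclideanSpace ℝ (Fin d))) :=
    {p | y p 1 - m p ∈ B ∧ ∀ g, y p g = m p + ρ g (y p 1 - m p)} with hC
  have hCc : IsClosed C := by
    refine IsClosed.inter (hB.preimage ((hy 1).sub hm)) ?_
    have : IsClosed {p | (fun g => y p g) = fun g => m p + ρ g (y p 1 - m p)} :=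
      isClosed_eq (continuous_pi hy)
        (continuous_pi fun g => hm.add ((ρ g).continuous.comp ((hy 1).sub hm)))
    simp only [funext_iff] at this
    exact this
  convert isClosedMap_snd_of_compactSpace C hCc using 1
  ext x
  constructor
  · rintro ⟨w, hw0, hw1, a, u, hu, hg⟩
    have hmean : m (⟨w, hw0, hw1⟩, x) = a := by
      simp only [m, y, hg, Finset.sum_add_distrib, hfull.sum_orbit_eq_zero u, add_zero]
      simp [← Nat.cast_smul_eq_nsmul ℝ, smul_smul]
    have hone : y (⟨w, hw0, hw1⟩, x) 1 - a = u := by simp [y, hg]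
    refine ⟨(⟨w, hw0, hw1⟩, x), ⟨?_, ?_⟩, rfl⟩
    · rw [hmean, hone]; exact hu
    · intro g; rw [hmean, hone]; exact hg g
  · rintro ⟨⟨⟨w, hw0, hw1⟩, x⟩, ⟨h1, h2⟩, rfl⟩
    exact ⟨w, hw0, hw1, _, _, h1, h2⟩

open MeasureTheory in
/-- The points of a vector space `D` lying over a closed set `B` are the linear images of a null
set of `X`, if `dim D < dim X`, or if `dim D = dim X` and `B` is null. -/
theorem exists_linearMap_nullSet_surjOn {D X E : Type*}
    [NormedAddCommGroup D] [NormedSpace ℝ D] [FiniteDimensional ℝ D]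
    [NormedAddCommGroup X] [NormedSpace ℝ X] [FiniteDimensional ℝ X]
    [MeasurableSpace X] [BorelSpace X] (μ : Measure X) [μ.IsAddHaarMeasure]
    [NormedAddCommGroup E] [NormedSpace ℝ E] [FiniteDimensional ℝ E]
    [MeasurableSpace E] [BorelSpace E] (ν : Measure E) [ν.IsAddHaarMeasure]
    (π : D →ₗ[ℝ] E) (hπ : Function.Surjective π) {B : Set E} (hB : IsClosed B)
    (h : Module.finrank ℝ D < Module.finrank ℝ X ∨
      Module.finrank ℝ D = Module.finrank ℝ X ∧ ν B = 0) :
    ∃ (L : X →ₗ[ℝ] D) (S : Set X), μ S = 0 ∧ Set.SurjOn L S (π ⁻¹' B) := by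
  rcases h with h | ⟨h, hν⟩
  · obtain ⟨i, hi⟩ : ∃ i : D →ₗ[ℝ] X, Function.Injective i :=
      finrank_le_iff_exists_linearMap.1 h.le
    obtain ⟨L, hL⟩ := i.exists_leftInverse_of_injective (LinearMap.ker_eq_bot.2 hi)
    refine ⟨L, LinearMap.range i, Measure.addHaar_submodule μ _ ?_, fun p _ => ⟨i p, ⟨p, rfl⟩, ?_⟩⟩
    · intro htop
      have := LinearMap.finrank_range_le i
      rw [htop, finrank_top] at this
      omega
    · exact LinearMap.congr_fun hL p
  · let e : X ≃ₗ[ℝ] D := LinearEquiv.ofFinrankEq _ _ h.symm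
    refine ⟨e, (π ∘ₗ e.toLinearMap) ⁻¹' B, ?_, fun p hp => ⟨e.symm p, by simpa using hp, by simp⟩⟩
    have := (ae_comp_linearMap_mem_iff (π ∘ₗ e.toLinearMap) μ ν (hπ.comp e.surjective)
      hB.measurableSet.compl).2 (by rw [ae_iff]; simpa using hν)
    rw [ae_iff] at this
    simpa [Set.preimage] using this

theorem sum_filter_eq_add_sum_subtype {ι κ M : Type*} [Fintype ι] [DecidableEq κ] [AddCommMonoid M]
    {c : ι → κ} {s : κ → ι} (hs : ∀ g, c (s g) = g) [Fintype {j // j ∉ Set.range s}] (f : ι → M)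
    (g : κ) :
    ∑ j with c j = g, f j = f (s g) + ∑ k : {j // j ∉ Set.range s} with c k.1 = g, f k := by
  classical
  rw [Finset.sum_filter, Finset.sum_filter,
    ← Fintype.sum_subtype_add_sum_subtype (fun j => j ∈ Set.range s)]
  congr 1
  · rw [Fintype.sum_eq_single (⟨s g, g, rfl⟩ : {j // j ∈ Set.range s})]
    · simp [hs]
    · rintro ⟨_, k, rfl⟩ hk
      rw [if_neg]
      rintro rfl
      simp [hs] at hk
  · convert rfl

/-- The position of one point of a color class depends differentiably on the weights and positions
of the other points and on the convex combination. -/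
theorem differentiableOn_solve_pivot {J E : Type*} [Fintype J] [NormedAddCommGroup E]
    [NormedSpace ℝ E] (t : Finset J) (A : E →L[ℝ] E) :
    DifferentiableOn ℝ (fun p : (J → ℝ × E) × (E × E) =>
      (1 - ∑ k ∈ t, (p.1 k).1)⁻¹ • (p.2.1 + A p.2.2 - ∑ k ∈ t, (p.1 k).1 • (p.1 k).2))
      {p | 1 - ∑ k ∈ t, (p.1 k).1 ≠ 0} := by
  have hd : Differentiable ℝ fun p : (J → ℝ × E) × (E × E) => 1 - ∑ k ∈ t, (p.1 k).1 := by
    fun_prop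
  refine DifferentiableOn.smul (hd.differentiableOn.inv fun p hp => hp) ?_
  fun_prop

-- Each color has a pivot `s g` of nonzero weight, whose position is determined by the remaining
-- data. The coincidences are thus covered by finitely many images of null sets under differentiable
-- maps between spaces of equal dimension.
open MeasureTheory in
theorem volume_orbitCoincidence_eq_zero {ι : Type*} [Fintype ι] [Finite G] (ρ : G →* OrthGroup d)
    {B : Set (EuclideanSpace ℝ (Fin d))} (hB : IsClosed B) (c : ι → G)
    (h : Nat.card ι + 2 * d < Nat.card G * (d + 1) ∨
      Nat.card ι + 2 * d = Nat.card G * (d + 1) ∧ volume B = 0) :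
    volume (orbitCoincidence ρ B c) = 0 := by
  classical
  have : Fintype G := Fintype.ofFinite G
  let E := EuclideanSpace ℝ (Fin d)
  let T : (G → ι) → Set (ι → E) := fun s => {x | (∀ g, c (s g) = g) ∧
    ∃ w : ι → ℝ, (∀ g, w (s g) ≠ 0) ∧ (∀ g, ∑ j with c j = g, w j = 1) ∧
      ∃ a, ∃ u ∈ B, ∀ g, ∑ j with c j = g, w j • x j = a + ρ g u}
  have hsub : orbitCoincidence ρ B c ⊆ ⋃ s, T s := by
    rintro x ⟨w, hw0, hw1, hx⟩
    have hpiv : ∀ g, ∃ j, c j = g ∧ w j ≠ 0 := by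
      intro g
      by_contra! hcon
      have := hw1 g
      rw [Finset.sum_eq_zero fun j hj => hcon j (by simpa using hj)] at this
      simp at this
    choose s hs using hpiv
    exact Set.mem_iUnion.2 ⟨s, fun g => (hs g).1, w, fun g => (hs g).2, hw1, hx⟩
  refine measure_mono_null hsub (measure_iUnion_null fun s => ?_)
  by_cases hs : ∀ g, c (s g) = g
  swap
  · convert measure_empty (μ := volume)
    ext x
    simp [T, hs]
  have hinj : Function.Injective s := fun a b hab => by rw [← hs a, ← hs b, hab]
  let J := {j // j ∉ Set.range s}
  have hJ : Fintype.card J + Fintype.card G = Fintype.card ι := by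
    have h1 := Fintype.card_subtype_compl (fun j => j ∈ Set.range s)
    have h2 : Fintype.card {j // j ∈ Set.range s} = Fintype.card G :=
      Set.card_range_of_injective hinj
    have h3 := Fintype.card_le_of_injective s hinj
    change Fintype.card J = _ at h1
    omega
  -- Weights and positions of the non-pivots, then `(a, u)`; pivot weights are recovered because
  -- each class sums to `1`.
  let D := (J → ℝ × E) × (E × E)
  let Φ : D → ι → E := fun p j => if hj : j ∉ Set.range s then (p.1 ⟨j, hj⟩).2 else
    (1 - ∑ k : J with c k.1 = c j, (p.1 k).1)⁻¹ •
      (p.2.1 + ρ (c j) p.2.2 - ∑ k : J with c k.1 = c j, (p.1 k).1 • (p.1 k).2)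
  have hfin : Module.finrank ℝ D + Fintype.card G * (d + 1) =
      Module.finrank ℝ (ι → E) + (Fintype.card ι + 2 * d) := by
    simp only [D, E, Module.finrank_prod, Module.finrank_pi_fintype, Module.finrank_self,
      finrank_euclideanSpace_fin, Finset.sum_const, Finset.card_univ, smul_eq_mul]
    rw [← hJ]
    ring
  obtain ⟨L, S, hS, hLS⟩ := exists_linearMap_nullSet_surjOn (D := D) (X := ι → E) (E := E) volume
    (volume : Measure E) (LinearMap.snd ℝ E E ∘ₗ LinearMap.snd ℝ (J → ℝ × E) (E × E))
    (fun u => ⟨(0, 0, u), rfl⟩) hB (by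
      rw [Nat.card_eq_fintype_card, Nat.card_eq_fintype_card] at h
      rcases h with h | ⟨h, hv⟩
      · left; omega
      · right; exact ⟨by omega, hv⟩)
  let R : Set D := {p | ∀ g, 1 - ∑ k : J with c k.1 = g, (p.1 k).1 ≠ 0}
  have hΦ : DifferentiableOn ℝ Φ R := by
    rw [differentiableOn_pi]
    intro j
    by_cases hj : j ∉ Set.range s
    · have h1 : Differentiable ℝ fun p : (J → ℝ × E) × (E × E) => (p.1 ⟨j, hj⟩).2 := by fun_prop
      exact h1.differentiableOn.congr fun p _ => dif_pos hj
    · have h1 := differentiableOn_solve_pivot (Finset.univ.filter fun k : J => c k.1 = c j)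
        ((ρ (c j)).toContinuousLinearEquiv : E →L[ℝ] E)
      exact (h1.mono fun p (hp : p ∈ R) => hp (c j)).congr fun p _ => dif_neg hj
  have hnull : volume ((Φ ∘ L) '' (S ∩ L ⁻¹' R)) = 0 := by
    refine addHaar_image_eq_zero_of_differentiableOn_of_addHaar_eq_zero volume
      (hΦ.comp (LinearMap.toContinuousLinearMap L).differentiable.differentiableOn
        (fun y hy => hy.2)) (measure_mono_null Set.inter_subset_left hS)
  refine measure_mono_null ?_ hnull
  rintro x ⟨-, w, hw, hw1, a, u, hu, hx⟩
  obtain ⟨y, hyS, hy⟩ := hLS (a := ((fun k : J => (w k, x k)), a, u)) hu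
  have hden : ∀ g, 1 - ∑ k : J with c k.1 = g, w k = w (s g) := fun g => by
    have := sum_filter_eq_add_sum_subtype hs w g
    rw [hw1] at this
    rw [this]; simp [J]
  have hnum : ∀ g, a + ρ g u - ∑ k : J with c k.1 = g, w k • x k = w (s g) • x (s g) := fun g => by
    have := sum_filter_eq_add_sum_subtype hs (fun j => w j • x j) g
    rw [hx] at this
    rw [this]; simp [J]
  refine ⟨y, ⟨hyS, ?_⟩, ?_⟩
  · rw [Set.mem_preimage, hy]
    intro g
    exact (hden g).trans_ne (hw g)
  · rw [Function.comp_apply, hy]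
    funext j
    by_cases hj : j ∉ Set.range s
    · simp only [Φ, dif_pos hj]
    · simp only [Φ, dif_neg hj]
      rw [hden, hnum]
      obtain ⟨g, rfl⟩ := not_not.1 hj
      rw [hs, inv_smul_smul₀ (hw g)]

end OrbitCoincidence

/-! ### Partitions versus coincidences, and existence -/

theorem exists_weights_of_mem_convexHull_image {ι E : Type*} [AddCommGroup E] [Module ℝ E]
    {f : ι → E} {t : Finset ι} {y : E} (hy : y ∈ convexHull ℝ (f '' t)) :
    ∃ w : ι → ℝ, (∀ j, 0 ≤ w j) ∧ ∑ j ∈ t, w j = 1 ∧ ∑ j ∈ t, w j • f j = y := by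
  classical
  obtain ⟨κ, _, v, z, hv0, hv1, hz, rfl⟩ := mem_convexHull_iff_exists_fintype.1 hy
  choose k hkt hk using hz
  refine ⟨fun j => ∑ i with k i = j, v i, fun j => Finset.sum_nonneg fun i _ => hv0 i, ?_, ?_⟩
  · rw [Finset.sum_fiberwise_of_maps_to fun i _ => hkt i, hv1]
  · rw [← Finset.sum_fiberwise_of_maps_to (s := Finset.univ) (fun i _ => hkt i) fun i => v i • z i]
    refine Finset.sum_congr rfl fun j _ => ?_
    rw [Finset.sum_smul]
    refine Finset.sum_congr rfl fun i hi => ?_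
    rw [← hk i, (Finset.mem_filter.1 hi).2]

section FreeOrbits

variable {G : Type*} [Group G] {d : ℕ}

/-- The orbit lies on a sphere about `a`, and every point of that sphere is extreme in the ball. -/
theorem extremePoints_orbitPolytope (ρ : G →* OrthGroup d) {u : EuclideanSpace ℝ (Fin d)}
    (hu : u ≠ 0) (a : EuclideanSpace ℝ (Fin d)) :
    Set.extremePoints ℝ (orbitPolytope ρ u a) = Set.range fun g : G => a + ρ g u := by
  refine Set.Subset.antisymm extremePoints_convexHull_subset ?_
  rintro _ ⟨g, rfl⟩
  refine inter_extremePoints_subset_extremePoints_of_subset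
    (A := Metric.closedBall a ‖u‖) (convexHull_min ?_ (convex_closedBall _ _))
    ⟨subset_convexHull ℝ _ ⟨g, rfl⟩,
      StrictConvexSpace.sphere_subset_extremePoints_closedBall a (norm_ne_zero_iff.2 hu) (by simp)⟩
  rintro _ ⟨h, rfl⟩
  simp

/-- A partition of a tuple of points for a free orbit polytope gives an orbit coincidence. -/
theorem exists_mem_orbitCoincidence {ι : Type*} [Fintype ι] [Finite G] {ρ : G →* OrthGroup d}
    {x : ι → EuclideanSpace ℝ (Fin d)} {P : Set (EuclideanSpace ℝ (Fin d))}
    (hP : IsFreeOrbitPolytope ρ P) (h : CanBePartitioned (Nat.card G) (Set.range x) P) :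
    ∃ c : ι → G, x ∈ orbitCoincidence ρ Set.univ c := by
  classical
  obtain ⟨u, a, hu, hfree, rfl⟩ := hP
  obtain ⟨A, hdisj, hun, y, hy, hrange⟩ := h
  rw [extremePoints_orbitPolytope ρ hu a] at hrange
  have hinj : Function.Injective fun g : G => a + ρ g u := by
    intro g h hgh
    have h1 : ρ g u = ρ h u := add_left_cancel hgh
    have h2 : ρ (h⁻¹ * g) u = u := by
      rw [map_mul, LinearIsometryEquiv.coe_mul, Function.comp_apply, h1, map_inv]
      exact (ρ h).symm_apply_apply u
    exact (inv_mul_eq_one.1 (hfree _ h2)).symm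
  choose i hi using fun g : G => hrange.symm ▸ Set.mem_range_self (f := fun g : G => a + ρ g u) g
  have hi_inj : Function.Injective i := fun g h hgh => hinj (by
    change a + ρ g u = a + ρ h u
    rw [← hi g, ← hi h, hgh])
  have hi_bij : Function.Bijective i := by
    have : Fintype G := Fintype.ofFinite G
    exact (Fintype.bijective_iff_injective_and_card i).2 ⟨hi_inj, by simp⟩
  let σ := Equiv.ofBijective i hi_bij
  choose col hcol using fun j : ι =>
    Set.mem_iUnion.1 (hun.symm ▸ Set.mem_range_self j : x j ∈ ⋃ i, A i)
  have hA : ∀ g, A (σ g) = x '' {j | σ.symm (col j) = g} := by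
    intro g
    ext z
    constructor
    · intro hz
      obtain ⟨j, rfl⟩ : z ∈ Set.range x := hun ▸ Set.mem_iUnion.2 ⟨_, hz⟩
      refine ⟨j, ?_, rfl⟩
      rw [Set.mem_ofPred_eq, Equiv.symm_apply_eq]
      by_contra hne
      exact Set.disjoint_left.1 (hdisj hne) (hcol j) hz
    · rintro ⟨j, hj, rfl⟩
      rw [Set.mem_ofPred_eq, Equiv.symm_apply_eq] at hj
      exact hj ▸ hcol j
  have hw : ∀ g, ∃ w : ι → ℝ, (∀ j, 0 ≤ w j) ∧ ∑ j with σ.symm (col j) = g, w j = 1 ∧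
      ∑ j with σ.symm (col j) = g, w j • x j = a + ρ g u := by
    intro g
    have h1 := hy (σ g)
    rw [hA, show y (σ g) = a + ρ g u from hi g] at h1
    exact exists_weights_of_mem_convexHull_image (by simpa using h1)
  choose w hw0 hw1 hwx using hw
  refine ⟨fun j => σ.symm (col j), fun j => w (σ.symm (col j)) j, fun j => hw0 _ _, fun g => ?_,
    a, u, trivial, fun g => ?_⟩
  · rw [← hw1 g]
    exact Finset.sum_congr rfl fun j hj => by
      simp only [(Finset.mem_filter.1 hj).2]
  · rw [← hwx g]
    exact Finset.sum_congr rfl fun j hj => by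
      simp only [(Finset.mem_filter.1 hj).2]

/-- An orbit coincidence in an injective tuple of points gives a partition for the orbit polytope. -/
theorem canBePartitioned_orbitPolytope {ι : Type*} [Fintype ι] [Finite G] {ρ : G →* OrthGroup d}
    {x : ι → EuclideanSpace ℝ (Fin d)} (hx : Function.Injective x) {c : ι → G} {w : ι → ℝ}
    {a u : EuclideanSpace ℝ (Fin d)} (hu : u ≠ 0) (hw0 : ∀ j, 0 ≤ w j)
    [DecidableEq G]
    (hw1 : ∀ g, ∑ j with c j = g, w j = 1)
    (hwx : ∀ g, ∑ j with c j = g, w j • x j = a + ρ g u) :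
    CanBePartitioned (Nat.card G) (Set.range x) (orbitPolytope ρ u a) := by
  let σ : Fin (Nat.card G) ≃ G := (Finite.equivFin G).symm
  refine ⟨fun i => x '' {j | c j = σ i}, ?_, ?_, fun i => a + ρ (σ i) u, ?_, ?_⟩
  · intro i k hik
    rw [Set.disjoint_image_iff hx, Set.disjoint_left]
    intro j hj hj'
    exact hik (σ.injective (hj.symm.trans hj'))
  · rw [← Set.image_iUnion, ← Set.image_univ]
    congr 1
    exact Set.eq_univ_of_forall fun j => Set.mem_iUnion.2 ⟨σ.symm (c j), by simp⟩
  · intro i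
    simp only [← hwx]
    exact (convex_convexHull ℝ _).sum_mem (fun j _ => hw0 j) (hw1 _) fun j hj =>
      subset_convexHull ℝ _ ⟨j, (Finset.mem_filter.1 hj).2, rfl⟩
  · rw [extremePoints_orbitPolytope ρ hu a]
    exact σ.surjective.range_comp fun g => a + ρ g u

theorem exists_mem_orbitCoincidence_univ {ι : Type*} [Fintype ι] [Finite G] {ρ : G →* OrthGroup d}
    (hfull : IsFullDimensional ρ) (hcard : Nat.card G * (d + 1) ≤ Nat.card ι + 2 * d)
    (x : ι → EuclideanSpace ℝ (Fin d)) : ∃ c : ι → G, x ∈ orbitCoincidence ρ Set.univ c := by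
  classical
  have : Fintype G := Fintype.ofFinite G
  let E := EuclideanSpace ℝ (Fin d)
  let Ψ : E × E × ℝ →ₗ[ℝ] G → E × ℝ := LinearMap.pi fun g =>
    (LinearMap.fst ℝ E (E × ℝ) + (ρ g).toLinearEquiv.toLinearMap ∘ₗ
      LinearMap.fst ℝ E ℝ ∘ₗ LinearMap.snd ℝ E (E × ℝ)).prod
        (LinearMap.snd ℝ E ℝ ∘ₗ LinearMap.snd ℝ E (E × ℝ))
  have hΨ : ∀ a u t g, Ψ (a, u, t) g = (a + ρ g u, t) := fun a u t g => rfl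
  have hΨinj : Function.Injective Ψ := by
    rw [injective_iff_map_eq_zero]
    rintro ⟨a, u, t⟩ h0
    have h1 : ∀ g, a + ρ g u = 0 ∧ t = 0 := fun g => by
      have := congrFun h0 g
      rw [hΨ] at this
      simpa using this
    have h2 : ∑ g : G, (a + ρ g u) = 0 := Finset.sum_eq_zero fun g _ => (h1 g).1
    rw [Finset.sum_add_distrib, hfull.sum_orbit_eq_zero u, add_zero] at h2
    have ha : a = 0 := by
      simpa [← Nat.cast_smul_eq_nsmul ℝ] using h2
    have hu : u = 0 := by simpa [ha] using (h1 1).1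
    simp [ha, hu, (h1 1).2]
  let L := LinearMap.range Ψ
  let F := EuclideanSpace ℝ (Fin (Module.finrank ℝ ((G → E × ℝ) ⧸ L)))
  let e : ((G → E × ℝ) ⧸ L) ≃ₗ[ℝ] F := LinearEquiv.ofFinrankEq _ _ (by simp [F])
  let q : (G → E × ℝ) →ₗ[ℝ] F := e.toLinearMap ∘ₗ L.mkQ
  have hq : ∀ v, q v = 0 ↔ ∃ a u t, Ψ (a, u, t) = v := by
    intro v
    simp [q, L]
  have hfin : Module.finrank ℝ F < Nat.card ι := by
    have h1 := L.finrank_quotient_add_finrank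
    have h2 : Module.finrank ℝ L = d + (d + 1) := by
      simp [L, LinearMap.finrank_range_of_inj hΨinj, E]
    have h3 : Module.finrank ℝ (G → E × ℝ) = Nat.card G * (d + 1) := by
      simp [E, Module.finrank_pi_fintype]
    simp only [F, finrank_euclideanSpace_fin]
    omega
  obtain ⟨c, hc⟩ := exists_zero_mem_convexHull_range_selection hfin
    (fun j g => q (Pi.single g (x j, 1))) (by
      intro j
      -- The copies sum to the constant tuple `(x j, 1) = Ψ (x j, 0, 1)`, which `q` kills.
      have : (0 : F) = ∑ g : G, (Fintype.card G : ℝ)⁻¹ • q (Pi.single g (x j, 1)) := by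
        rw [← Finset.smul_sum, ← map_sum, Finset.univ_sum_single (fun _ => (x j, (1 : ℝ))),
          (hq _).2 ⟨x j, 0, 1, ?_⟩, smul_zero]
        funext g
        simp [hΨ]
      rw [this]
      exact (convex_convexHull ℝ _).sum_mem (fun _ _ => by positivity) (by simp)
        fun g _ => subset_convexHull ℝ _ ⟨g, rfl⟩)
  refine ⟨c, ?_⟩
  obtain ⟨w, hw0, hw1, hw⟩ : ∃ w : ι → ℝ, (∀ j, 0 ≤ w j) ∧ ∑ j, w j = 1 ∧
      ∑ j, w j • q (Pi.single (c j) (x j, 1)) = 0 := by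
    rw [← Set.image_univ, ← Finset.coe_univ] at hc
    exact exists_weights_of_mem_convexHull_image hc
  simp_rw [← map_smul, ← map_sum] at hw
  obtain ⟨a, u, t, haut⟩ := (hq _).1 hw
  have hcoord : ∀ g, a + ρ g u = ∑ j with c j = g, w j • x j ∧ t = ∑ j with c j = g, w j := by
    intro g
    have := congrFun haut g
    rw [hΨ, Finset.sum_apply] at this
    have h1 : ∀ j, (w j • Pi.single (M := fun _ => E × ℝ) (c j) (x j, (1 : ℝ))) g =
        if c j = g then (w j • x j, w j) else 0 := by
      intro j
      by_cases hj : c j = g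
      · subst hj; simp
      · simp [hj]
    simp_rw [h1, ← Finset.sum_filter] at this
    rw [Prod.ext_iff, Prod.fst_sum, Prod.snd_sum] at this
    exact this
  -- The last coordinate of `L` forces every class to have the same total weight `t`, so scaling by
  -- the order of `G` normalizes all classes at once.
  have ht : (Fintype.card G : ℝ) * t = 1 := by
    rw [← hw1, ← Finset.sum_fiberwise Finset.univ c w, ← Finset.sum_congr rfl
      fun g _ => (hcoord g).2]
    simp
  refine ⟨fun j => Fintype.card G * w j, fun j => mul_nonneg (by positivity) (hw0 j), fun g => ?_,
    (Fintype.card G : ℝ) • a, (Fintype.card G : ℝ) • u, trivial, fun g => ?_⟩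
  · rw [← Finset.mul_sum, ← (hcoord g).2, ht]
  · simp_rw [mul_smul]
    rw [← Finset.smul_sum, ← (hcoord g).1, map_smul, smul_add]

end FreeOrbits

/-! ### Null sets of degenerate vectors and tuples -/

section Degenerate

open MeasureTheory

variable {G : Type*} [Group G] {d : ℕ}

/-- A polynomial in `t` with leading coefficient `A.det ≠ 0` has finitely many roots. -/
theorem volume_det_add_smul_eq_zero {n : Type*} [Fintype n] [DecidableEq n] (A B : Matrix n n ℝ)
    (hA : A.det ≠ 0) : volume {t : ℝ | (B + t • A).det = 0} = 0 := by
  let p : Polynomial ℝ :=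
    ((Polynomial.X : Polynomial ℝ) • A.map Polynomial.C + B.map Polynomial.C).det
  have hp : p ≠ 0 := fun h => hA (by
    rw [← Polynomial.coeff_det_X_add_C_card A B]
    exact (congrArg (fun q => Polynomial.coeff q _) h).trans (Polynomial.coeff_zero _))
  have heval : ∀ t, p.eval t = (B + t • A).det := fun t => by
    rw [← Polynomial.coe_evalRingHom, RingHom.map_det]
    congr 1
    ext i j
    simp only [Polynomial.coe_evalRingHom, RingHom.mapMatrix_apply, Matrix.map_apply,
      Matrix.add_apply, Matrix.smul_apply, smul_eq_mul, Polynomial.eval_add, Polynomial.eval_mul,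
      Polynomial.eval_X, Polynomial.eval_C]
    ring
  refine Set.Finite.measure_zero ((p.roots.toFinset.finite_toSet).subset fun t ht => ?_) _
  simp only [Finset.mem_coe, Multiset.mem_toFinset, Polynomial.mem_roots hp, Polynomial.IsRoot.def,
    heval]
  exact ht

/-- The vectors outside some closed null set have orbits of full dimension. -/
theorem IsFullDimensional.exists_isClosed_volume_eq_zero {ρ : G →* OrthGroup d}
    (hfull : IsFullDimensional ρ) :
    ∃ B : Set (EuclideanSpace ℝ (Fin d)), IsClosed B ∧ volume B = 0 ∧
      ∀ u ∉ B, affineSpan ℝ (Set.range fun g : G => ρ g u) = ⊤ := by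
  obtain ⟨v, hv⟩ := hfull
  let E := EuclideanSpace ℝ (Fin d)
  have hspan : Submodule.span ℝ (Set.range fun g : G => ρ g v - v) = ⊤ := by
    have h1 := vectorSpan_range_eq_span_range_vsub_right ℝ (fun g : G => ρ g v) 1
    rw [← direction_affineSpan, hv, AffineSubspace.direction_top] at h1
    simpa using h1.symm
  have hsel := Submodule.exists_fun_fin_finrank_span_eq ℝ (Set.range fun g : G => ρ g v - v)
  obtain ⟨n, hn⟩ : ∃ n, Module.finrank ℝ E = n := ⟨_, rfl⟩
  rw [hspan, finrank_top, hn] at hsel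
  obtain ⟨f, hfmem, -, hfind⟩ := hsel
  choose g hg using hfmem
  let b : Module.Basis (Fin n) ℝ E := Module.finBasisOfFinrankEq ℝ E hn
  let M : E →ₗ[ℝ] Matrix (Fin n) (Fin n) ℝ :=
    { toFun := fun u => b.toMatrix fun i => ρ (g i) u - u
      map_add' := fun u w => by
        ext i j
        simp [Module.Basis.toMatrix_apply]
        ring
      map_smul' := fun c u => by
        ext i j
        simp [Module.Basis.toMatrix_apply]
        ring }
  have hM : ∀ u, (M u).det ≠ 0 ↔ LinearIndependent ℝ fun i => ρ (g i) u - u := fun u => by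
    rw [← isUnit_iff_ne_zero]
    change IsUnit (b.det fun i => ρ (g i) u - u) ↔ _
    rw [← Module.Basis.is_basis_iff_det]
    exact ⟨fun h => h.1, fun h => ⟨h, h.span_eq_top_of_card_eq_finrank' (by rw [Fintype.card_fin, hn])⟩⟩
  have hMv : (M v).det ≠ 0 := (hM v).2 (by
    rwa [show (fun i => ρ (g i) v - v) = f from funext hg])
  have hclosed : IsClosed {u : E | (M u).det = 0} :=
    isClosed_eq (Continuous.matrix_det (LinearMap.continuous_of_finiteDimensional M))
      continuous_const
  refine ⟨{u | (M u).det = 0}, hclosed, ?_, fun u hu => ?_⟩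
  -- Fubini along lines parallel to `v`: each meets the zero set of the determinant in a null set,
  -- as `(M v).det ≠ 0`.
  · have := ae_mem_of_ae_add_linearMap_mem (LinearMap.toSpanSingleton ℝ E v) volume
      (volume : Measure E) hclosed.measurableSet.compl fun y => by
        rw [ae_iff]
        simpa using volume_det_add_smul_eq_zero _ (M y) hMv
    rw [ae_iff] at this
    simpa using this
  · have hind := (hM u).1 hu
    have htop := hind.span_eq_top_of_card_eq_finrank' (by rw [Fintype.card_fin, hn])
    have hne : (affineSpan ℝ (Set.range fun g : G => ρ g u) : Set E).Nonempty :=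
      ⟨ρ 1 u, subset_affineSpan ℝ _ ⟨1, rfl⟩⟩
    rw [← AffineSubspace.direction_eq_top_iff_of_nonempty hne, direction_affineSpan,
      vectorSpan_range_eq_span_range_vsub_right ℝ (fun g : G => ρ g u) 1, eq_top_iff, ← htop]
    refine Submodule.span_mono ?_
    rintro _ ⟨i, rfl⟩
    exact ⟨g i, by simp⟩

theorem volume_fixedPoints_eq_zero {A : OrthGroup d} (hA : A ≠ 1) :
    volume {u | A u = u} = 0 := by
  let K := LinearMap.eqLocus A.toLinearEquiv.toLinearMap (LinearMap.id (R := ℝ))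
  refine Measure.addHaar_submodule volume K fun h => hA ?_
  ext1 u
  exact (h ▸ Submodule.mem_top : u ∈ K)

theorem isClosed_setOf_not_injective {ι X : Type*} [Finite ι] [TopologicalSpace X] [T2Space X] :
    IsClosed {x : ι → X | ¬ Function.Injective x} := by
  have : {x : ι → X | ¬ Function.Injective x} =
      ⋃ p : {p : ι × ι // p.1 ≠ p.2}, {x | x p.1.1 = x p.1.2} := by
    ext x
    simp [Function.Injective, and_comm]
  rw [this]
  exact isClosed_iUnion_of_finite fun p =>
    isClosed_eq (continuous_apply _) (continuous_apply _)

theorem volume_setOf_not_injective {ι : Type*} [Fintype ι] (hd : d ≠ 0) :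
    volume {x : ι → EuclideanSpace ℝ (Fin d) | ¬ Function.Injective x} = 0 := by
  classical
  have : NeZero d := ⟨hd⟩
  have hsub : {x : ι → EuclideanSpace ℝ (Fin d) | ¬ Function.Injective x} ⊆
      ⋃ p : {p : ι × ι // p.1 ≠ p.2}, {x | x p.1.1 = x p.1.2} := by
    intro x
    simp [Function.Injective, and_comm]
  refine measure_mono_null hsub (measure_iUnion_null fun p => ?_)
  let K : Submodule ℝ (ι → EuclideanSpace ℝ (Fin d)) :=
    LinearMap.eqLocus (LinearMap.proj p.1.1) (LinearMap.proj p.1.2)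
  refine Measure.addHaar_submodule volume K fun h => ?_
  obtain ⟨v, hv⟩ := exists_ne (0 : EuclideanSpace ℝ (Fin d))
  have : Pi.single p.1.1 v ∈ K := h ▸ Submodule.mem_top
  simp [K, LinearMap.mem_eqLocus, Pi.single_eq_of_ne p.2.symm, hv] at this

theorem holdsGenerically_of_isClosed {N : ℕ} {p : (Fin N → EuclideanSpace ℝ (Fin d)) → Prop}
    {S : Set (Fin N → EuclideanSpace ℝ (Fin d))} (hS : IsClosed S) (h0 : volume S = 0)
    (hp : ∀ x ∉ S, p x) : HoldsGenerically p :=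
  ⟨Sᶜ, hS.isOpen_compl, Measure.dense_of_ae (μ := volume) (by rw [ae_iff]; simpa using h0),
    by rwa [compl_compl], hp⟩

end Degenerate

/-! ### The main theorem -/

open MeasureTheory in
theorem theorem1p2 {G : Type*} [Group G] [Finite G] (r d : ℕ) (hr : Nat.card G = r) (hr3 : 3 ≤ r)
    (ρ : G →* OrthGroup d) (hfaithful : Function.Injective ρ) (hfull : IsFullDimensional ρ) :
    HoldsGenerically (fun x : Fin ((r - 2) * (d + 1) + 2) → EuclideanSpace ℝ (Fin d) =>
      ∃ P : Set (EuclideanSpace ℝ (Fin d)),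
        IsFreeOrbitPolytope ρ P ∧ affineSpan ℝ P = ⊤ ∧ CanBePartitioned r (Set.range x) P) ∧
    ∀ N : ℕ, N < (r - 2) * (d + 1) + 2 →
      HoldsGenerically (fun x : Fin N → EuclideanSpace ℝ (Fin d) =>
        ¬ ∃ P : Set (EuclideanSpace ℝ (Fin d)),
          IsFreeOrbitPolytope ρ P ∧ CanBePartitioned r (Set.range x) P) := by
  classical
  have hcount : (r - 2) * (d + 1) + 2 + 2 * d = r * (d + 1) := by
    obtain ⟨k, rfl⟩ := Nat.exists_eq_add_of_le (show 2 ≤ r by omega)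
    rw [Nat.add_sub_cancel_left]
    ring
  constructor
  · obtain ⟨g₀, hg₀⟩ : ∃ g : G, g ≠ 1 := by
      have : Nontrivial G := Finite.one_lt_card_iff_nontrivial.1 (by omega)
      exact exists_ne 1
    have hd : d ≠ 0 := by
      rintro rfl
      exact hg₀ (hfaithful (LinearIsometryEquiv.ext fun u => Subsingleton.elim _ _))
    obtain ⟨B₀, hB₀c, hB₀n, hB₀⟩ := hfull.exists_isClosed_volume_eq_zero
    -- The bad `u`: orbit not full-dimensional, or nontrivial stabilizer (null by faithfulness).
    let B := B₀ ∪ ⋃ g : {g : G // g ≠ 1}, {u | ρ g u = u}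
    have hBc : IsClosed B := hB₀c.union <| isClosed_iUnion_of_finite fun g =>
      isClosed_eq (ρ g).continuous continuous_id
    have hBn : volume B = 0 := measure_union_null hB₀n <| measure_iUnion_null fun g =>
      volume_fixedPoints_eq_zero fun h => g.2 (hfaithful (h.trans (map_one ρ).symm))
    refine holdsGenerically_of_isClosed (S := {x | ¬ Function.Injective x} ∪
        ⋃ c : Fin ((r - 2) * (d + 1) + 2) → G, orbitCoincidence ρ B c)
      (isClosed_setOf_not_injective.union
        (isClosed_iUnion_of_finite fun c => isClosed_orbitCoincidence hfull hBc c))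
      (measure_union_null (volume_setOf_not_injective hd) (measure_iUnion_null fun c =>
        volume_orbitCoincidence_eq_zero ρ hBc c (Or.inr ⟨by simp [hr, hcount], hBn⟩))) ?_
    intro x hx
    rw [Set.mem_union, not_or, Set.mem_iUnion, not_exists] at hx
    obtain ⟨hinj, hx⟩ := hx
    obtain ⟨c, w, hw0, hw1, a, u, -, hau⟩ :=
      exists_mem_orbitCoincidence_univ hfull (by simp [hr, hcount]) x
    have hu : u ∉ B := fun hu => hx c ⟨w, hw0, hw1, a, u, hu, hau⟩
    have hfree : ∀ g : G, ρ g u = u → g = 1 := fun g hg => by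
      by_contra hne
      exact hu (Or.inr (Set.mem_iUnion.2 ⟨⟨g, hne⟩, hg⟩))
    have hu0 : u ≠ 0 := by
      rintro rfl
      exact hg₀ (hfree g₀ (map_zero _))
    refine ⟨orbitPolytope ρ u a, ⟨u, a, hu0, hfree, rfl⟩, ?_, ?_⟩
    · rw [orbitPolytope, affineSpan_convexHull]
      have h1 := hB₀ u fun h => hu (Or.inl h)
      let τ := AffineEquiv.constVAdd ℝ (EuclideanSpace ℝ (Fin d)) a
      have h2 := AffineSubspace.map_span τ.toAffineMap
        (Set.range fun g : G => ρ g u)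
      rw [h1, ← Set.range_comp] at h2
      rw [← AffineMap.map_top_of_surjective τ.toAffineMap τ.surjective]
      exact h2.symm
    · convert canBePartitioned_orbitPolytope (not_not.1 hinj) hu0 hw0 hw1 hau
      exact hr.symm
  · intro N hN
    refine holdsGenerically_of_isClosed (S := ⋃ c : Fin N → G, orbitCoincidence ρ Set.univ c)
      (isClosed_iUnion_of_finite fun c => isClosed_orbitCoincidence hfull isClosed_univ c)
      (measure_iUnion_null fun c => volume_orbitCoincidence_eq_zero ρ isClosed_univ c
        (Or.inl (by rw [hr, ← hcount]; simpa using hN))) ?_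
    rintro x hx ⟨P, hP, hpart⟩
    exact hx (Set.mem_iUnion.2 (exists_mem_orbitCoincidence hP (hr ▸ hpart)))
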